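/- An overpartition of a nonnegative integer $n$ is a partition of $n$ in which the first occurrence of a part of each size may be overlined or not; a negative integer has no overpartitions. Let $S(m,n)$ be the total number of non-overlined parts equal to $m$ in all the overpartitions of $n$, and put $$A(\phi,1,0;n)=\sum_{m\ge 1} S(m,n)\,\phi(m),$$ where $\phi$ is Euler's totient function (so $A(\phi,1,0;n)=0$ for $n\le 0$). For $k\ge 1$ let $\overline{M}_k(n)$ be the number of overpartitions of $n$ that have a part larger than $k$ and in which the smallest part size larger than $k$ appears at least $k+1$ times (counting overlined and non-overlined copies together). Then, for every integer $m$, $A(\phi,1,0;m)$ equals the sum of the non-overlined parts counted without multiplicity in all the overpartitions of $m$ (each overpartition contributes the sum of its distinct non-overlined part sizes), and for all integers $k,n>0$, $$(-1)^{k}\left(A(\phi,1,0;n)+2\sum_{j=1}^{k}(-1)^j A(\phi,1,0;n-j^2)-n\right)=\sum_{j=1}^{n} j\,\overline{M}_k(n-j).$$ -/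

import Mathlib

/-- An overpartition of `n`: a partition of `n` in which the first occurrence of a part of each
size may be overlined or not. It is recorded by the underlying partition and the set of those
part sizes whose first occurrence is overlined. -/
@[ext]
structure Overpartition (n : ℕ) where
  toPartition : n.Partition
  overlined : Finset ℕ
  overlined_subset : overlined ⊆ toPartition.parts.toFinset

namespace Overpartition

/-- An overpartition is a partition together with a subset of its set of part sizes. -/
def equivSigma (n : ℕ) :
    (Σ p : n.Partition, {s : Finset ℕ // s ∈ p.parts.toFinset.powerset}) ≃ Overpartition n where
  toFun x := ⟨x.1, x.2.1, Finset.mem_powerset.1 x.2.2⟩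
  invFun π := ⟨π.toPartition, π.overlined, Finset.mem_powerset.2 π.overlined_subset⟩
  left_inv _ := rfl
  right_inv _ := rfl

instance instFintype (n : ℕ) : Fintype (Overpartition n) :=
  Fintype.ofEquiv _ (equivSigma n)

/-- All parts, overlined or not, with multiplicity. -/
def parts {n : ℕ} (π : Overpartition n) : Multiset ℕ := π.toPartition.parts

/-- The non-overlined parts, with multiplicity: one copy of every overlined size is removed. -/
def nonOverlinedParts {n : ℕ} (π : Overpartition n) : Multiset ℕ :=
  π.parts - π.overlined.val

/-- `S(m, n)`: the number of non-overlined parts equal to `m` in all the overpartitions of `n`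
(there are no overpartitions of a negative integer). -/
def S (m : ℕ) : ℤ → ℕ
  | Int.ofNat n => ∑ π : Overpartition n, π.nonOverlinedParts.count m
  | Int.negSucc _ => 0

/-- `A(a, α, β; n) = ∑_{m ≥ 1} S(α m - β, n) a_m`, for `0 ≤ β < α`. Only finitely many terms
are nonzero. -/
noncomputable def A (a : ℕ → ℂ) (α β : ℕ) (n : ℤ) : ℂ :=
  ∑' m : ℕ, (S (α * (m + 1) - β) n : ℂ) * a (m + 1)

/-- The sum of the non-overlined parts counted without multiplicity, in all the overpartitions
of `n`: each overpartition contributes the sum of its distinct non-overlined part sizes. -/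
def distinctSum : ℤ → ℕ
  | Int.ofNat n => ∑ π : Overpartition n, ∑ m ∈ π.nonOverlinedParts.toFinset, m
  | Int.negSucc _ => 0

/-- The overpartition has a part larger than `k`, and the first (that is, smallest) part size
larger than `k` appears at least `k + 1` times, overlined and non-overlined copies together. -/
def FirstLargePartRepeats (k : ℕ) {n : ℕ} (π : Overpartition n) : Prop :=
  ∃ m ∈ π.parts.toFinset, k < m ∧ (∀ i ∈ π.parts.toFinset, k < i → m ≤ i) ∧ k + 1 ≤ π.parts.count m

instance instDecidableFirstLargePartRepeats (k n : ℕ) (π : Overpartition n) :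
    Decidable (FirstLargePartRepeats k π) := by
  unfold FirstLargePartRepeats
  infer_instance

/-- `M̄_k(n)`: the number of overpartitions of `n` in which the first part larger than `k`
appears at least `k + 1` times. -/
def M (k n : ℕ) : ℕ :=
  (Finset.univ.filter fun π : Overpartition n => FirstLargePartRepeats k π).card

end Overpartition

/-! ### Counting by removal of non-overlined parts. -/

section Counting

open Finset

namespace Overpartition

/-! Write p(n) for `count n`. Removing i non-overlined copies of m shows that p(n - im)
overpartitions of n have at least i of them. Hence S(m,n) is the sum of p(n - d) over m ∣ d, and
Gauss's ∑_{m∣d} φ(m) = d gives A(n) = ∑ d p(n - d). The case i = 1 gives the same value for the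
distinct sum.

The second claim is the convolution with d of `truncated_gauss`, the same identity with p(n) for
A(n), [n = 0] for n and M_k(n) on the right. That follows by induction on k from M_{k+1}(n) + M_k(n)
= 2p(n - (k+1)²) (`M_succ_add_M`), which is a telescoping sum of generating functions
(`sum_repeatSeries_succ`). -/

/-- The number of overpartitions of an integer; it is zero for negative integers. -/
def count : ℤ → ℕ
  | Int.ofNat n => Fintype.card (Overpartition n)
  | Int.negSucc _ => 0

@[simp]
theorem count_natCast (n : ℕ) : count (n : ℤ) = Fintype.card (Overpartition n) := rfl

theorem count_of_neg {z : ℤ} (hz : z < 0) : count z = 0 := by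
  cases z with
  | ofNat n => exact absurd hz (by simp)
  | negSucc n => rfl

theorem nodup_overlined_le {n : ℕ} (π : Overpartition n) : π.overlined.val ≤ π.parts :=
  Finset.val_le_iff_val_subset.2 fun _ hx => Multiset.mem_toFinset.1 (π.overlined_subset hx)

theorem count_nonOverlinedParts {n : ℕ} (π : Overpartition n) (m : ℕ) :
    π.nonOverlinedParts.count m = π.parts.count m - π.overlined.val.count m :=
  Multiset.count_sub ..

theorem replicate_le_parts {n i m : ℕ} {π : Overpartition n}
    (hi : i ≤ π.nonOverlinedParts.count m) : Multiset.replicate i m ≤ π.parts :=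
  Multiset.le_count_iff_replicate_le.1
    (hi.trans (Multiset.count_le_of_le _ (Multiset.sub_le_self _ _)))

theorem mul_le_of_le_count {n i m : ℕ} {π : Overpartition n}
    (hi : i ≤ π.nonOverlinedParts.count m) : i * m ≤ n := by
  obtain ⟨u, hu⟩ := Multiset.le_iff_exists_add.1 (replicate_le_parts hi)
  have h1 := congrArg Multiset.sum hu
  rw [Multiset.sum_add, Multiset.sum_replicate, smul_eq_mul] at h1
  have h2 : π.parts.sum = n := π.toPartition.parts_sum
  lia

theorem count_nonOverlinedParts_mul_le {n : ℕ} (π : Overpartition n) (m : ℕ) :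
    π.nonOverlinedParts.count m * m ≤ n :=
  mul_le_of_le_count le_rfl

/-- Adjoin `i` non-overlined copies of the part `m`. -/
def addParts {l n : ℕ} (π : Overpartition l) (i m : ℕ) (hm : 0 < m) (h : l + i * m = n) :
    Overpartition n where
  toPartition :=
    { parts := π.parts + Multiset.replicate i m
      parts_pos := by
        intro j hj
        rcases Multiset.mem_add.1 hj with hj | hj
        · exact π.toPartition.parts_pos hj
        · exact (Multiset.eq_of_mem_replicate hj) ▸ hm
      parts_sum := by
        rw [Multiset.sum_add, Multiset.sum_replicate, smul_eq_mul, ← h]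
        exact congrArg (· + i * m) π.toPartition.parts_sum }
  overlined := π.overlined
  overlined_subset x hx := by
    have := Multiset.mem_toFinset.1 (π.overlined_subset hx)
    exact Multiset.mem_toFinset.2 (Multiset.mem_add.2 (Or.inl this))

/-- Remove `i` non-overlined copies of the part `m`. -/
def removeParts {l n : ℕ} (π : Overpartition n) (i m : ℕ) (h : l + i * m = n)
    (hi : i ≤ π.nonOverlinedParts.count m) : Overpartition l where
  toPartition :=
    { parts := π.parts - Multiset.replicate i m
      parts_pos := fun hj => π.toPartition.parts_pos
        (Multiset.mem_of_le (Multiset.sub_le_self _ _) hj)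
      parts_sum := by
        have hs := congrArg Multiset.sum (Multiset.sub_add_cancel (replicate_le_parts hi))
        rw [Multiset.sum_add, Multiset.sum_replicate, smul_eq_mul] at hs
        have := π.toPartition.parts_sum
        change π.parts.sum = n at this
        lia }
  overlined := π.overlined
  overlined_subset x hx := by
    have h1 := Multiset.count_pos.2 (Multiset.mem_toFinset.1 (π.overlined_subset hx))
    change 0 < π.parts.count x at h1
    refine Multiset.mem_toFinset.2 (Multiset.count_pos.1 ?_)
    rw [Multiset.count_sub, Multiset.count_replicate]
    split_ifs with hxm
    -- An overlined m has one copy not counted in `hi`, so it survives the removal.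
    · subst hxm
      rw [count_nonOverlinedParts] at hi
      have h2 : π.overlined.val.count m = 1 := Multiset.count_eq_one_of_mem π.overlined.nodup hx
      lia
    · simpa using h1

theorem card_filter_le_count_nonOverlinedParts (n i m : ℕ) (hm : 0 < m) :
    #{π : Overpartition n | i ≤ π.nonOverlinedParts.count m} = count (n - i * m) := by
  by_cases hle : i * m ≤ n
  · obtain ⟨l, rfl⟩ := Nat.exists_eq_add_of_le' hle
    have : ((l + i * m : ℕ) : ℤ) - i * m = (l : ℕ) := by push_cast; ring
    rw [this, count_natCast, ← Finset.card_univ]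
    symm
    refine Finset.card_bij' (fun π _ => π.addParts i m hm rfl)
      (fun π hπ => π.removeParts i m rfl (Finset.mem_filter.1 hπ).2) ?_ ?_ ?_ ?_
    · intro π _
      refine Finset.mem_filter.2 ⟨Finset.mem_univ _, ?_⟩
      rw [count_nonOverlinedParts]
      change i ≤ (π.parts + Multiset.replicate i m).count m - π.overlined.val.count m
      have := Multiset.count_le_of_le m π.nodup_overlined_le
      rw [Multiset.count_add, Multiset.count_replicate_self]
      lia
    · intro _ _
      exact Finset.mem_univ _
    · intro π _
      apply Overpartition.ext
      · apply Nat.Partition.ext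
        exact Multiset.add_sub_cancel_right
      · rfl
    · intro π hπ
      have hi := (Finset.mem_filter.1 hπ).2
      apply Overpartition.ext
      · apply Nat.Partition.ext
        exact Multiset.sub_add_cancel (replicate_le_parts hi)
      · rfl
  · rw [count_of_neg (by push Not at hle; zify at hle; lia), Finset.card_eq_zero,
      Finset.filter_eq_empty_iff]
    intro π _ hi
    exact hle (mul_le_of_le_count hi)

/-- A multiplicity c is the number of i with 1 ≤ i ≤ c; put d = i * m. The bound `N` is free so that
all the shifts n - j² can share one range of summation. -/
theorem S_eq_sum_count {z : ℤ} {N m : ℕ} (hz : z ≤ N) (hm : 0 < m) :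
    S m z = ∑ d ∈ Icc 1 N with m ∣ d, count (z - d) := by
  cases z with
  | negSucc n =>
    symm
    apply Finset.sum_eq_zero
    intro d _
    exact count_of_neg (by have := Int.negSucc_lt_zero n; lia)
  | ofNat n =>
    have hn : n ≤ N := by simpa using hz
    have key (π : Overpartition n) : π.nonOverlinedParts.count m =
        ∑ d ∈ Icc 1 N with m ∣ d, if d / m ≤ π.nonOverlinedParts.count m then 1 else 0 := by
      rw [← Finset.card_filter]
      have hc : #(Icc 1 (π.nonOverlinedParts.count m)) = π.nonOverlinedParts.count m := by simp
      conv_lhs => rw [← hc]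
      refine Finset.card_bij' (fun i _ => i * m) (fun d _ => d / m) ?_ ?_ ?_ ?_
      · intro i hi
        rw [Finset.mem_Icc] at hi
        simp only [Finset.mem_filter, Finset.mem_Icc]
        refine ⟨⟨⟨Nat.mul_pos hi.1 hm, ?_⟩, Dvd.intro_left i rfl⟩, ?_⟩
        · exact (Nat.mul_le_mul_right m hi.2).trans
            ((π.count_nonOverlinedParts_mul_le m).trans hn)
        · rw [Nat.mul_div_cancel _ hm]
          exact hi.2
      · intro d hd
        simp only [Finset.mem_filter, Finset.mem_Icc] at hd
        exact Finset.mem_Icc.2 ⟨Nat.div_pos (Nat.le_of_dvd hd.1.1.1 hd.1.2) hm, hd.2⟩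
      · intro i _
        exact Nat.mul_div_cancel _ hm
      · intro d hd
        simp only [Finset.mem_filter, Finset.mem_Icc] at hd
        exact Nat.div_mul_cancel hd.1.2
    change ∑ π : Overpartition n, π.nonOverlinedParts.count m = _
    rw [Finset.sum_congr rfl fun π _ => key π, Finset.sum_comm]
    refine Finset.sum_congr rfl fun d hd => ?_
    have hd := (Finset.mem_filter.1 hd).2
    rw [← Finset.card_filter, card_filter_le_count_nonOverlinedParts n (d / m) m hm]
    congr 2
    exact_mod_cast Nat.div_mul_cancel hd

theorem S_eq_zero_of_lt {z : ℤ} {m : ℕ} (hm : 0 < m) (h : z < m) : S m z = 0 := by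
  rw [S_eq_sum_count (N := m - 1) (by lia) hm, Finset.filter_false_of_mem, Finset.sum_empty]
  intro d hd hdvd
  rw [Finset.mem_Icc] at hd
  have := Nat.le_of_dvd hd.1 hdvd
  lia

theorem distinctSum_eq_sum_count {z : ℤ} {N : ℕ} (hz : z ≤ N) :
    distinctSum z = ∑ d ∈ Icc 1 N, d * count (z - d) := by
  cases z with
  | negSucc n =>
    symm
    apply Finset.sum_eq_zero
    intro d _
    rw [count_of_neg (by have := Int.negSucc_lt_zero n; lia), mul_zero]
  | ofNat n =>
    have hn : n ≤ N := by simpa using hz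
    have key (π : Overpartition n) : ∑ m ∈ π.nonOverlinedParts.toFinset, m =
        ∑ d ∈ Icc 1 N, d * if 1 ≤ π.nonOverlinedParts.count d then 1 else 0 := by
      simp only [mul_ite, mul_one, mul_zero]
      rw [← Finset.sum_filter]
      refine Finset.sum_congr ?_ fun _ _ => rfl
      ext d
      simp only [Multiset.mem_toFinset, Finset.mem_filter, Finset.mem_Icc,
        Multiset.one_le_count_iff_mem]
      refine ⟨fun hd => ⟨⟨?_, ?_⟩, hd⟩, And.right⟩
      · exact π.toPartition.parts_pos (Multiset.mem_of_le (Multiset.sub_le_self _ _) hd)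
      · have h1 := π.count_nonOverlinedParts_mul_le d
        have h2 := Multiset.one_le_count_iff_mem.2 hd
        exact ((Nat.le_mul_of_pos_left d h2).trans h1).trans hn
    change ∑ π : Overpartition n, ∑ m ∈ π.nonOverlinedParts.toFinset, m = _
    rw [Finset.sum_congr rfl fun π _ => key π, Finset.sum_comm]
    refine Finset.sum_congr rfl fun d hd => ?_
    rw [← Finset.mul_sum, ← Finset.card_filter,
      card_filter_le_count_nonOverlinedParts n 1 d (Finset.mem_Icc.1 hd).1]
    congr 3
    simp

theorem A_totient_eq_sum_count {z : ℤ} {N : ℕ} (hz : z ≤ N) :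
    A (fun d => (Nat.totient d : ℂ)) 1 0 z = ∑ d ∈ Icc 1 N, (d : ℂ) * count (z - d) := by
  have h1 : A (fun d => (Nat.totient d : ℂ)) 1 0 z =
      ∑ m ∈ range N, (S (m + 1) z : ℂ) * Nat.totient (m + 1) := by
    unfold A
    simp only [one_mul, Nat.sub_zero]
    refine tsum_eq_sum fun m hm => ?_
    rw [Finset.mem_range] at hm
    rw [S_eq_zero_of_lt (Nat.succ_pos m) (by push_cast; lia), Nat.cast_zero, zero_mul]
  have h2 : ∑ m ∈ range N, S (m + 1) z * Nat.totient (m + 1) =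
      ∑ m ∈ Icc 1 N, S m z * Nat.totient m := by
    rw [Finset.range_eq_Ico, Finset.sum_Ico_add' (fun m => S m z * Nat.totient m) 0 N 1]
    rfl
  have h3 : ∑ m ∈ Icc 1 N, S m z * Nat.totient m = ∑ d ∈ Icc 1 N, d * count (z - d) := by
    have (m) (hm : m ∈ Icc 1 N) : S m z * Nat.totient m =
        ∑ d ∈ Icc 1 N, if m ∣ d then count (z - d) * Nat.totient m else 0 := by
      rw [S_eq_sum_count hz (Finset.mem_Icc.1 hm).1, Finset.sum_mul, Finset.sum_filter]
    rw [Finset.sum_congr rfl this, Finset.sum_comm]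
    refine Finset.sum_congr rfl fun d hd => ?_
    rw [Finset.mem_Icc] at hd
    rw [← Finset.sum_filter, ← Finset.mul_sum, mul_comm]
    congr 1
    conv_rhs => rw [← Nat.sum_totient d]
    refine Finset.sum_congr ?_ fun _ _ => rfl
    ext m
    simp only [Finset.mem_filter, Finset.mem_Icc, Nat.mem_divisors]
    refine ⟨fun h => ⟨h.2, by lia⟩, fun h => ⟨⟨Nat.pos_of_dvd_of_pos h.1 hd.1, ?_⟩, h.1⟩⟩
    exact (Nat.le_of_dvd hd.1 h.1).trans hd.2
  rw [h1]
  exact_mod_cast h2.trans h3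

end Overpartition

end Counting

/-! ### Generating functions and telescoping. -/

section GeneratingFunctions

open Finset PowerSeries
open scoped PowerSeries.WithPiTopology

namespace Nat.Partition

variable {R : Type*} [CommRing R]

/-- The factor contributed by the part `m` to the product formula for `genFun`, if `f c` is the
weight of `c` copies of `m`. -/
noncomputable def genFunFactor [TopologicalSpace R] (f : ℕ → R) (m : ℕ) : R⟦X⟧ :=
  1 + ∑' j, f (j + 1) • (X : R⟦X⟧) ^ (m * (j + 1))

/-- In the product over part sizes, weight 0 for every positive multiplicity of m turns the factor
of m into 1. -/
theorem genFun_eq_mul_update [TopologicalSpace R] [IsTopologicalRing R] [T2Space R]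
    (f : ℕ → ℕ → R) {m : ℕ} (hm : 0 < m) :
    genFun f = genFunFactor (f m) m * genFun (Function.update f m 0) := by
  obtain ⟨m, rfl⟩ := Nat.exists_eq_add_one_of_ne_zero hm.ne'
  have h1 := hasProd_genFun (Function.update f (m + 1) 0)
  have h2 := (hasProd_ite_eq m (genFunFactor (f (m + 1)) (m + 1))).mul h1
  refine (hasProd_genFun f).unique (Eq.mp (congrArg (HasProd · _ _) (funext fun i => ?_)) h2)
  by_cases hi : i = m
  · subst hi
    simp [genFunFactor]
  · rw [if_neg hi, one_mul, Function.update_of_ne (by lia)]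

end Nat.Partition

namespace Overpartition

open Nat.Partition

/-- The geometric series `1 / (1 - q ^ m)`. -/
noncomputable def geom (m : ℕ) : ℤ⟦X⟧ := ∑' j, (X ^ m) ^ j

theorem one_sub_mul_geom {m : ℕ} (hm : 0 < m) : (1 - X ^ m) * geom m = 1 :=
  WithPiTopology.one_sub_mul_tsum_pow_of_constantCoeff_eq_zero (by simp [hm.ne'])

theorem genFunFactor_ite_le {m : ℕ} (hm : 0 < m) (r : ℕ) :
    genFunFactor (fun c => (if r + 1 ≤ c then 2 else 0 : ℤ)) m =
      1 + 2 * X ^ (m * (r + 1)) * geom m := by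
  have hs := summable_genFun_term' (fun _ c => (if r + 1 ≤ c then 2 else 0 : ℤ)) hm.ne'
  rw [genFunFactor, ← hs.sum_add_tsum_nat_add r, Finset.sum_eq_zero, zero_add]
  · have hg : Summable fun j => ((X : ℤ⟦X⟧) ^ m) ^ j :=
      WithPiTopology.summable_pow_of_constantCoeff_eq_zero (by simp [hm.ne'])
    rw [geom, ← hg.tsum_mul_left]
    congr 1
    refine tsum_congr fun j => ?_
    rw [if_pos (by lia), PowerSeries.smul_eq_C_mul, ← pow_mul, mul_assoc, ← pow_add,
      show (2 : ℤ⟦X⟧) = C 2 from rfl]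
    congr 2
    ring
  · intro j hj
    rw [Finset.mem_range] at hj
    rw [if_neg (by lia), PowerSeries.smul_eq_C_mul, map_zero, zero_mul]

/-- The generating function of the overpartitions all of whose parts are at most `k` or
larger than `m`. -/
noncomputable def gapSeries (k m : ℕ) : ℤ⟦X⟧ :=
  genFun fun i _ => if i ≤ k ∨ m < i then 2 else 0

theorem genFun_eq_of_update {f g : ℕ → ℕ → ℤ} {m : ℕ} (hm : 0 < m) (r : ℕ)
    (hf : ∀ c, f m c = if r + 1 ≤ c then 2 else 0) (hg : g m = 0)
    (hfg : ∀ i, i ≠ m → f i = g i) :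
    genFun f = (1 + 2 * X ^ (m * (r + 1)) * geom m) * genFun g := by
  have : Function.update f m 0 = g := by
    ext1 i
    by_cases hi : i = m
    · subst hi
      simp [hg]
    · rw [Function.update_of_ne hi, hfg i hi]
  rw [genFun_eq_mul_update f hm, this, funext hf, genFunFactor_ite_le hm]

/-- Only part sizes that occur contribute a weight, so values at multiplicity 0 are irrelevant. -/
theorem genFun_congr_of_pos {f g : ℕ → ℕ → ℤ} (h : ∀ i c, 0 < c → f i c = g i c) :
    genFun f = genFun g := by
  ext n
  simp only [coeff_genFun]
  refine Finset.sum_congr rfl fun p _ => Finsupp.prod_congr fun i hi => h _ _ ?_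
  exact Nat.pos_of_ne_zero (Finsupp.mem_support_iff.1 hi)

theorem gapSeries_succ_left {k m : ℕ} (h : k < m) :
    gapSeries (k + 1) m = (1 + X ^ (k + 1)) * geom (k + 1) * gapSeries k m := by
  have h1 : gapSeries (k + 1) m = (1 + 2 * X ^ ((k + 1) * (0 + 1)) * geom (k + 1)) *
      gapSeries k m := by
    rw [gapSeries, genFun_congr_of_pos (g := fun i c => if i ≤ k ∨ m < i then 2
      else if i = k + 1 then if 0 + 1 ≤ c then 2 else 0 else 0)]
    · refine genFun_eq_of_update k.add_one_pos 0 (fun c => ?_) ?_ fun i hi => ?_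
      · rw [if_neg (by lia), if_pos rfl]
      · ext c
        exact if_neg (by lia)
      · ext c
        simp [hi]
    · intro i c hc
      grind
  rw [h1]
  -- This is 1 + 2x/(1 - x) = (1 + x)/(1 - x) with x = q^(k+1).
  linear_combination (-gapSeries k m) * one_sub_mul_geom k.add_one_pos

theorem gapSeries_right {k m : ℕ} (h : k ≤ m) :
    gapSeries k m = (1 + X ^ (m + 1)) * geom (m + 1) * gapSeries k (m + 1) := by
  have h1 : gapSeries k m = (1 + 2 * X ^ ((m + 1) * (0 + 1)) * geom (m + 1)) *
      gapSeries k (m + 1) := by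
    rw [gapSeries, genFun_congr_of_pos (g := fun i c => if i ≤ k ∨ m + 1 < i then 2
      else if i = m + 1 then if 0 + 1 ≤ c then 2 else 0 else 0)]
    · refine genFun_eq_of_update m.add_one_pos 0 (fun c => ?_) ?_ fun i hi => ?_
      · rw [if_neg (by lia), if_pos rfl]
      · ext c
        exact if_neg (by lia)
      · ext c
        simp [hi]
    · intro i c hc
      grind
  rw [h1]
  linear_combination (-gapSeries k (m + 1)) * one_sub_mul_geom m.add_one_pos

theorem gapSeries_self (k : ℕ) : gapSeries k k = gapSeries 0 0 := by
  unfold gapSeries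
  ext n
  simp only [coeff_genFun]
  refine Finset.sum_congr rfl fun p _ => Finsupp.prod_congr fun i hi => ?_
  grind

/-- Each part size is overlined or not independently; this is why the weights above are 2 per size.
-/
theorem sum_toPartition {n : ℕ} (g : n.Partition → ℤ) :
    ∑ π : Overpartition n, g π.toPartition =
      ∑ p : n.Partition, 2 ^ #p.parts.toFinset * g p := by
  rw [← (equivSigma n).sum_comp, Fintype.sum_sigma]
  refine Finset.sum_congr rfl fun p _ => ?_
  change ∑ _ : {s : Finset ℕ // s ∈ p.parts.toFinset.powerset}, g p = _
  rw [Finset.sum_const, Finset.card_univ, Fintype.card_coe, Finset.card_powerset, nsmul_eq_mul]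
  push_cast
  rfl

theorem coeff_gapSeries_zero (n : ℕ) :
    coeff n (gapSeries 0 0) = Fintype.card (Overpartition n) := by
  have h := sum_toPartition (n := n) fun _ => 1
  rw [Finset.sum_const, Finset.card_univ, nsmul_eq_mul, mul_one] at h
  rw [h, gapSeries, coeff_genFun]
  refine Finset.sum_congr rfl fun p _ => ?_
  simp only [Finsupp.prod, Multiset.toFinsupp_support, mul_one]
  rw [Finset.prod_congr rfl fun i _ => if_pos (by lia), Finset.prod_const]

theorem coeff_gapSeries_zero_self (n : ℕ) :
    coeff n (gapSeries 0 n) = if n = 0 then 1 else 0 := by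
  split_ifs with hn
  · subst hn
    rw [coeff_gapSeries_zero, ← Nat.cast_one, Nat.cast_inj]
    rw [← Finset.card_univ]
    decide
  · rw [gapSeries, coeff_genFun]
    refine Finset.sum_eq_zero fun p _ => ?_
    have hp : p.parts ≠ 0 := by
      intro h0
      have := p.parts_sum
      rw [h0, Multiset.sum_zero] at this
      exact hn this.symm
    obtain ⟨i, hi⟩ := Multiset.exists_mem_of_ne_zero hp
    refine Finset.prod_eq_zero (i := i) (by simpa using hi) (if_neg ?_)
    have h1 := p.parts_pos hi
    have h2 := Multiset.le_sum_of_mem hi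
    rw [p.parts_sum] at h2
    lia

/-- The generating function of the overpartitions whose smallest part larger than `k` is `m`,
appearing at least `k + 1` times. -/
noncomputable def repeatSeries (k m : ℕ) : ℤ⟦X⟧ :=
  2 * X ^ (m * (k + 1)) * geom m * gapSeries k m

/-- `genFun f` allows m either no times or at least k + 1 times, and no other size in (k, m];
subtracting `gapSeries k m` discards the case where m is absent. -/
theorem coeff_repeatSeries {k m : ℕ} (h : k < m) (n : ℕ) :
    coeff n (repeatSeries k m) = ∑ p : n.Partition, 2 ^ #p.parts.toFinset *
      if m ∈ p.parts ∧ (∀ i ∈ p.parts, k < i → m ≤ i) ∧ k + 1 ≤ p.parts.count m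
        then 1 else 0 := by
  set f : ℕ → ℕ → ℤ := fun i c => if i ≤ k ∨ m < i then 2
      else if i = m then if k + 1 ≤ c then 2 else 0 else 0 with hf
  have h1 : genFun f = (1 + 2 * X ^ (m * (k + 1)) * geom m) * gapSeries k m := by
    refine genFun_eq_of_update (by lia) k (fun c => ?_) ?_ fun i hi => ?_
    · exact (if_neg (by lia)).trans (if_pos rfl)
    · ext c
      exact if_neg (by lia)
    · ext c
      simp [hf, hi]
  have h2 : repeatSeries k m = genFun f - gapSeries k m := by
    rw [h1, repeatSeries]
    ring
  rw [h2, map_sub, gapSeries, coeff_genFun, coeff_genFun, ← Finset.sum_sub_distrib]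
  refine Finset.sum_congr rfl fun p _ => ?_
  simp only [Finsupp.prod, Multiset.toFinsupp_support, Multiset.toFinsupp_apply]
  by_cases hm : m ∈ p.parts
  · have h0 : ∏ i ∈ p.parts.toFinset, (if i ≤ k ∨ m < i then 2 else 0 : ℤ) = 0 :=
      Finset.prod_eq_zero (Multiset.mem_toFinset.2 hm) (if_neg (by lia))
    rw [h0, sub_zero]
    split_ifs with hc
    · rw [mul_one, ← Finset.prod_const]
      refine Finset.prod_congr rfl fun i hi => ?_
      have := hc.2.1 i (Multiset.mem_toFinset.1 hi)
      simp only [hf]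
      by_cases him : i = m
      · subst him
        simp [hc.2.2]
      · rw [if_pos (by lia)]
    · rw [mul_zero]
      by_cases hc' : k + 1 ≤ p.parts.count m
      · have : ∃ i ∈ p.parts, k < i ∧ i < m := by
          by_contra! hcon
          exact hc ⟨hm, hcon, hc'⟩
        obtain ⟨i, hi, hki, him⟩ := this
        refine Finset.prod_eq_zero (Multiset.mem_toFinset.2 hi) ?_
        simp only [hf]
        rw [if_neg (by lia), if_neg (by lia)]
      · refine Finset.prod_eq_zero (Multiset.mem_toFinset.2 hm) ?_
        exact (if_neg (by lia)).trans ((if_pos rfl).trans (if_neg hc'))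
  · rw [if_neg (fun hc => hm hc.1), mul_zero, sub_eq_zero]
    refine Finset.prod_congr rfl fun i hi => ?_
    have : i ≠ m := by
      rintro rfl
      exact hm (Multiset.mem_toFinset.1 hi)
    simp [hf, this]

theorem M_eq_sum_coeff (k n : ℕ) :
    (M k n : ℤ) = ∑ m ∈ Ioc k n, coeff n (repeatSeries k m) := by
  rw [M, Finset.card_filter]
  push_cast
  rw [Finset.sum_congr rfl fun m hm => coeff_repeatSeries (Finset.mem_Ioc.1 hm).1 n,
    Finset.sum_comm]
  simp only [← Finset.mul_sum]
  rw [← sum_toPartition]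
  refine Finset.sum_congr rfl fun π _ => ?_
  split_ifs with hπ
  · obtain ⟨m, hm, hkm, hmin, hc⟩ := hπ
    have hm' : m ∈ π.toPartition.parts := Multiset.mem_toFinset.1 hm
    have hmn : m ≤ n := (Multiset.le_sum_of_mem hm').trans_eq π.toPartition.parts_sum
    rw [Finset.sum_eq_single_of_mem m (Finset.mem_Ioc.2 ⟨hkm, hmn⟩), if_pos]
    · exact ⟨hm', fun i hi => hmin i (Multiset.mem_toFinset.2 hi), hc⟩
    · intro b hb hbm
      refine if_neg fun hb' => hbm (le_antisymm (hb'.2.1 m hm' hkm) ?_)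
      exact hmin b (Multiset.mem_toFinset.2 hb'.1) (Finset.mem_Ioc.1 hb).1
  · symm
    refine Finset.sum_eq_zero fun m hm => if_neg fun h => hπ ?_
    exact ⟨m, Multiset.mem_toFinset.2 h.1, (Finset.mem_Ioc.1 hm).1,
      fun i hi => h.2.1 i (Multiset.mem_toFinset.1 hi), h.2.2⟩

theorem sum_repeatSeries_zero (n : ℕ) :
    ∑ m ∈ Ioc 0 n, repeatSeries 0 m = gapSeries 0 0 - gapSeries 0 n := by
  induction n with
  | zero => simp
  | succ n ih =>
    rw [Finset.sum_Ioc_succ_top n.zero_le, ih, gapSeries_right n.zero_le, repeatSeries]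
    linear_combination (-gapSeries 0 (n + 1)) * one_sub_mul_geom n.add_one_pos

theorem M_zero (n : ℕ) : (M 0 n : ℤ) = count n - if n = 0 then 1 else 0 := by
  rw [M_eq_sum_coeff, ← map_sum, sum_repeatSeries_zero, map_sub, coeff_gapSeries_zero,
    coeff_gapSeries_zero_self, count_natCast]

/-- The last term is the remainder after truncating the sums over m; passing from l to l + 1 peels
the factor of k + 2 + l off its gap series. -/
theorem sum_repeatSeries_succ (k l : ℕ) :
    ∑ m ∈ Ioc (k + 1) (k + 1 + l), repeatSeries (k + 1) m +
      ∑ m ∈ Ioc k (k + 1 + l), repeatSeries k m =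
    2 * X ^ ((k + 1) ^ 2) * gapSeries 0 0 -
      2 * geom (k + 1) * X ^ ((k + 1) * (k + 2 + l)) * gapSeries k (k + 1 + l) := by
  induction l with
  | zero =>
    rw [← gapSeries_self (k + 1), gapSeries_succ_left k.lt_succ_self]
    simp only [add_zero, Finset.Ioc_self, Finset.sum_empty, zero_add]
    rw [Finset.sum_Ioc_succ_top le_rfl, Finset.Ioc_self, Finset.sum_empty, zero_add,
      repeatSeries]
    ring
  | succ l ih =>
    rw [← add_assoc, Finset.sum_Ioc_succ_top (by lia), Finset.sum_Ioc_succ_top (by lia)]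
    have h1 : gapSeries k (k + 1 + l) = _ := gapSeries_right (by lia)
    rw [h1] at ih
    rw [repeatSeries, repeatSeries, gapSeries_succ_left (by lia)]
    linear_combination ih - 2 * X ^ ((k + 1) * (k + 1 + l + 1)) * gapSeries k (k + 1 + l + 1) *
      (geom (k + 1 + l + 1) * one_sub_mul_geom k.add_one_pos +
        geom (k + 1) * X ^ (k + 1) * one_sub_mul_geom (k + 1 + l).add_one_pos)

theorem M_succ_add_M (k n : ℕ) :
    (M (k + 1) n : ℤ) + M k n = 2 * count ((n : ℤ) - ((k + 1 : ℕ) : ℤ) ^ 2) := by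
  have hM (j : ℕ) (hj : j ≤ k + 1) :
      (M j n : ℤ) = ∑ m ∈ Ioc j (k + 1 + n), coeff n (repeatSeries j m) := by
    rw [M_eq_sum_coeff]
    refine Finset.sum_subset (Finset.Ioc_subset_Ioc_right (by lia)) fun m hm hmn => ?_
    rw [Finset.mem_Ioc] at hm hmn
    -- Terms with m > n have order above n, so both sums may run to k + 1 + n; with l = n the
    -- remainder vanishes too.
    have hlt : n < m * (j + 1) :=
      lt_of_lt_of_le (by lia) (Nat.le_mul_of_pos_right m j.add_one_pos)
    rw [repeatSeries, mul_comm 2, mul_assoc, mul_assoc, coeff_X_pow_mul', if_neg (by lia)]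
  rw [hM _ le_rfl, hM k k.le_succ, ← map_sum, ← map_sum, ← map_add, sum_repeatSeries_succ, map_sub]
  have h1 : coeff n (2 * geom (k + 1) * X ^ ((k + 1) * (k + 2 + n)) *
      gapSeries k (k + 1 + n)) = 0 := by
    have hlt : n < (k + 1) * (k + 2 + n) := by nlinarith
    rw [mul_right_comm, mul_comm, coeff_X_pow_mul', if_neg (by lia)]
  have h2 : coeff n (2 * X ^ ((k + 1) ^ 2) * gapSeries 0 0) =
      2 * (count ((n : ℤ) - ((k + 1 : ℕ) : ℤ) ^ 2) : ℤ) := by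
    rw [mul_assoc, show (2 : ℤ⟦X⟧) = C 2 from rfl, coeff_C_mul, coeff_X_pow_mul']
    split_ifs with h
    · rw [coeff_gapSeries_zero, ← count_natCast]
      push_cast [h]
      rfl
    · rw [count_of_neg (by push Not at h; zify at h; push_cast; lia), Nat.cast_zero]
  rw [h1, h2, sub_zero]

end Overpartition

end GeneratingFunctions

/-! ### Truncated Gauss identity and conclusion. -/

namespace Overpartition

open Finset in
theorem truncated_gauss (k n : ℕ) :
    (-1 : ℤ) ^ k * (count n + 2 * ∑ j ∈ Icc 1 k, (-1 : ℤ) ^ j * count ((n : ℤ) - (j : ℤ) ^ 2)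
      - if n = 0 then 1 else 0) = M k n := by
  induction k with
  | zero => simp [M_zero]
  | succ k ih =>
    rw [Finset.sum_Icc_succ_top (by lia), eq_sub_of_add_eq (M_succ_add_M k n), ← ih]
    have h : (-1 : ℤ) ^ k * (-1) ^ k = 1 := by rw [← mul_pow]; simp
    linear_combination 2 * (count ((n : ℤ) - ((k + 1 : ℕ) : ℤ) ^ 2) : ℤ) * h

end Overpartition

theorem corollaryC61 (k n : ℕ) (hk : 0 < k) (hn : 0 < n) :
    (∀ m : ℤ, Overpartition.A (fun d => (Nat.totient d : ℂ)) 1 0 m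
      = (Overpartition.distinctSum m : ℂ)) ∧
    (-1 : ℂ) ^ k *
        (Overpartition.A (fun d => (Nat.totient d : ℂ)) 1 0 (n : ℤ)
          + 2 * ∑ j ∈ Finset.Icc 1 k,
              (-1 : ℂ) ^ j *
                Overpartition.A (fun d => (Nat.totient d : ℂ)) 1 0 ((n : ℤ) - (j : ℤ) ^ 2)
          - (n : ℂ))
      = ∑ j ∈ Finset.Icc 1 n, (j : ℂ) * (Overpartition.M k (n - j) : ℂ) := by
  refine ⟨fun m => ?_, ?_⟩
  · rw [Overpartition.A_totient_eq_sum_count m.self_le_toNat,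
      Overpartition.distinctSum_eq_sum_count m.self_le_toNat]
    push_cast
    rfl
  · have hA (j : ℕ) := Overpartition.A_totient_eq_sum_count (z := (n : ℤ) - (j : ℤ) ^ 2) (N := n)
      (by nlinarith)
    rw [Overpartition.A_totient_eq_sum_count le_rfl]
    simp only [hA]
    -- The term n is the convolution of d with [n - d = 0]; the natural subtraction is exact as d ≤
    -- n.
    have hn' : (n : ℂ) = ∑ d ∈ Finset.Icc 1 n, (d : ℂ) * if n - d = 0 then 1 else 0 := by
      rw [Finset.sum_eq_single_of_mem n (Finset.mem_Icc.2 ⟨hn, le_rfl⟩)]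
      · simp
      · intro d hd hdn
        rw [Finset.mem_Icc] at hd
        rw [if_neg (by lia), mul_zero]
    have hswap : ∑ j ∈ Finset.Icc 1 k, (-1 : ℂ) ^ j *
          ∑ d ∈ Finset.Icc 1 n, (d : ℂ) * Overpartition.count ((n : ℤ) - (j : ℤ) ^ 2 - d) =
        ∑ d ∈ Finset.Icc 1 n, (d : ℂ) *
          ∑ j ∈ Finset.Icc 1 k, (-1 : ℂ) ^ j * Overpartition.count ((n : ℤ) - d - (j : ℤ) ^ 2) := by
      simp only [Finset.mul_sum]
      rw [Finset.sum_comm]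
      refine Finset.sum_congr rfl fun d _ => Finset.sum_congr rfl fun j _ => ?_
      rw [sub_right_comm, mul_left_comm]
    conv_lhs => rw [hn', hswap]
    rw [Finset.mul_sum (a := 2), ← Finset.sum_add_distrib, ← Finset.sum_sub_distrib,
      Finset.mul_sum]
    refine Finset.sum_congr rfl fun d hd => ?_
    have h := congrArg (Int.cast : ℤ → ℂ) (Overpartition.truncated_gauss k (n - d))
    rw [Nat.cast_sub (Finset.mem_Icc.1 hd).2] at h
    push_cast at h
    rw [← h]
    ring
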